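/- Let $\mathcal H$ be a separable infinite-dimensional complex Hilbert space and let $z\in B(\mathcal H)$ be a selfadjoint operator with finite spectrum $\sigma(z)=\{a_j\}_{j=-m}^{n+r}$, where $m,n\ge 0$ and $r\ge 1$ are integers, $a_{-m}<\dots<a_{n+r}$, $a_0=0$ and $a_{n+1}=1$. Let $p_j=\chi_{\{a_j\}}(z)$ be the spectral projections, so that $z=\sum_j a_jp_j$, and assume that $\mathrm{tr}(p_j)<\infty$ for $j<0$ and for $j>n+1$. Let $\{e_k\}_{k\in\mathbb N}$ be an orthonormal basis of $\mathcal H$, let $d_k=\langle ze_k,e_k\rangle$ be the diagonal of $z$, put $$a=\sum_{d_k\le 1/2}d_k,\qquad b=\sum_{d_k>1/2}(1-d_k),$$ and let $q$ be the orthogonal projection onto $\overline{\mathrm{span}}\{e_k : d_k>1/2\}$. Suppose that $a+b<\infty$, that is, both series converge unconditionally to finite sums. Then: (i) $\mathrm{tr}(p_j)<\infty$ for $0<j<n+1$; (ii) $p_{n+1}-q$ is compact and $$a-b-\sum_{j\ne n+1}a_j\,\mathrm{tr}(p_j)=[p_{n+1}:q],$$ with the convention $0\cdot\infty=0$; in particular,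 the left-hand side is an integer. Here, for projections $p,q$ with $p-q$ compact, the essential codimension $[p:q]$ is $\mathrm{tr}(p)-\mathrm{tr}(q)$ if both traces are finite, and otherwise (both are then infinite) it is the Fredholm index $\dim\ker(v^*w)-\dim\mathrm{coker}(v^*w)$ for any isometries $w,v\in B(\mathcal H)$ with $ww^*=p$ and $vv^*=q$. -/

import Mathlib

open scoped InnerProductSpace ENNReal

noncomputable section

variable {H : Type*} [NormedAddCommGroup H] [InnerProductSpace ℂ H]

theorem tsum_sq_inner {ι : Type*} (e : HilbertBasis ι ℂ H) (x : H) :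
    ∑' i, ENNReal.ofReal (‖⟪e i, x⟫_ℂ‖ ^ 2) = ENNReal.ofReal (‖x‖ ^ 2) := by
  have h := e.hasSum_inner_mul_inner x x
  have h2 := Complex.reCLM.hasSum h
  have h3 : HasSum (fun i => ‖⟪e i, x⟫_ℂ‖ ^ 2) (‖x‖ ^ 2) := by
    convert h2 using 1
    · funext i
      have : ⟪x, e i⟫_ℂ * ⟪e i, x⟫_ℂ = ((‖⟪e i, x⟫_ℂ‖ ^ 2 : ℝ) : ℂ) := by
        rw [← inner_conj_symm x (e i), Complex.conj_mul']; push_cast; rfl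
      simp only [this, Complex.reCLM_apply, Complex.ofReal_re]
    · rw [inner_self_eq_norm_sq_to_K]
      simp [← Complex.ofReal_pow]
  rw [← h3.tsum_eq, ENNReal.ofReal_tsum_of_nonneg (fun _ => by positivity) h3.summable]

variable [CompleteSpace H]

/-- The trace, with values in `[0, ∞]`, of a positive bounded operator `T` on a Hilbert space: the
sum of the diagonal entries `⟪eᵢ, T eᵢ⟫` along some orthonormal basis. By `posTrace_eq_tsum` below
it does not depend on the basis. -/
def posTrace (T : H →L[ℂ] H) : ℝ≥0∞ :=
  ∑' i : (exists_hilbertBasis ℂ H).choose,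
    ENNReal.ofReal (RCLike.re ⟪(exists_hilbertBasis ℂ H).choose_spec.choose i,
      T ((exists_hilbertBasis ℂ H).choose_spec.choose i)⟫_ℂ)

/-- The trace of a positive operator can be computed along any orthonormal basis. -/
theorem posTrace_eq_tsum {ι : Type*} (e : HilbertBasis ι ℂ H) {T : H →L[ℂ] H}
    (hT : T.IsPositive) :
    posTrace T = ∑' i, ENNReal.ofReal (RCLike.re ⟪e i, T (e i)⟫_ℂ) := by
  have hT0 : 0 ≤ T := (ContinuousLinearMap.nonneg_iff_isPositive T).2 hT
  obtain ⟨S, hSa, hST⟩ : ∃ S : H →L[ℂ] H, IsSelfAdjoint S ∧ S * S = T :=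
    ⟨CFC.sqrt T, (CFC.sqrt_nonneg T).isSelfAdjoint, CFC.sqrt_mul_sqrt_self T hT0⟩
  have hS : ∀ x y, ⟪S x, y⟫_ℂ = ⟪x, S y⟫_ℂ := fun x y => by
    have := ContinuousLinearMap.adjoint_inner_left S y x
    rwa [hSa.adjoint_eq] at this
  have key : ∀ x, RCLike.re ⟪x, T x⟫_ℂ = ‖S x‖ ^ 2 := fun x => by
    rw [← hST, mul_apply_eq_comp, ← hS, inner_self_eq_norm_sq]
  unfold posTrace
  set f := (exists_hilbertBasis ℂ H).choose_spec.choose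
  simp only [key]
  simp_rw [fun x => (tsum_sq_inner e (S x)).symm]
  rw [ENNReal.tsum_comm]
  refine tsum_congr fun i => ?_
  rw [tsum_sq_inner e, ← tsum_sq_inner f]
  refine tsum_congr fun j => ?_
  rw [← hS, norm_inner_symm]

/-- The diagonal of `z` with respect to the orthonormal basis `e` (its entries are real when `z` is
selfadjoint). -/
def diagEntry (e : HilbertBasis ℕ ℂ H) (z : H →L[ℂ] H) (n : ℕ) : ℝ :=
  RCLike.re ⟪e n, z (e n)⟫_ℂ

/-- The orthogonal projection `q` onto the closed span of `{eₙ | dₙ > 1/2}`. -/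
def upperProj (e : HilbertBasis ℕ ℂ H) (z : H →L[ℂ] H) : H →L[ℂ] H :=
  (Submodule.span ℂ (e '' {n | 1 / 2 < diagEntry e z n})).topologicalClosure.starProjection

/-- The spectral projection `χ_{c}(z)` of a selfadjoint operator `z` with finite spectrum, by the
continuous functional calculus (every function is continuous on a finite spectrum). -/
def spectralProj (z : H →L[ℂ] H) (c : ℝ) : H →L[ℂ] H :=
  cfc (Set.indicator {c} (fun _ : ℝ => (1 : ℝ))) z

/-- `w` and `v` are isometries of `H` with range projections `p` and `q`. -/
def IsometriesOnto (p q w v : H →L[ℂ] H) : Prop :=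
  star w * w = 1 ∧ w * star w = p ∧ star v * v = 1 ∧ v * star v = q

open Classical in
/-- The essential codimension `[p : q]` of two projections whose difference is compact, on a
separable infinite-dimensional Hilbert space: `tr p - tr q` if both traces are finite; otherwise
both are infinite, and it is the Fredholm index `dim ker - dim coker` of `v* w` for isometries
`w`, `v` of the whole space with `w w* = p` and `v v* = q`. (The index does not depend on the choice
of `w` and `v`: another choice changes `v* w` by unitary factors on both sides.) -/
def essCodim (p q : H →L[ℂ] H) : ℝ :=
  if posTrace p < ∞ ∧ posTrace q < ∞ then (posTrace p).toReal - (posTrace q).toReal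
  else if h : ∃ wv : (H →L[ℂ] H) × (H →L[ℂ] H), IsometriesOnto p q wv.1 wv.2 then
    ((star h.choose.2 * h.choose.1 : H →L[ℂ] H).toLinearMap.index : ℝ)
  else 0

end

/-! Let `x j k` be the squared norm of p_j e_k. For each k, the numbers x_j(k) sum to 1 over j, and
weighted by a_j they sum to d_k. Where d_k ≤ 1/2 the sum of the a_j x_j is summable and its negative
part is controlled by the hypothesis, so every x_j with a_j > 0 is summable there. Where d_k > 1/2
the same holds for 1 - d_k with weights 1 - a_j. Together these give finite trace for 0 < j < n+1.

Subtracting the summable terms leaves ‖p e_k‖² - ‖q e_k‖², with p = p_{n+1}, so this sums to the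
left-hand side of (ii). As q is diagonal, its absolute value is ‖(p - q) e_k‖²; hence p - q is
Hilbert–Schmidt, thus compact, and the sum equals ‖p(1-q)‖² - ‖(1-p)q‖² in Hilbert–Schmidt norms
(`hasSum_of_diagonal`).

For infinite traces put T = v*w. The two norms are the traces of 1 - T*T and 1 - TT*, and their
difference is the index of T (`index_eq_posTrace_sub`). With R, S the square roots of these defects,
‖R^k‖² - ‖S^k‖² does not depend on k ≥ 1, while the even powers converge strongly to the projections
onto ker T and ker T*. -/

open Filter Topology

noncomputable section

/-! ### Hilbert–Schmidt norms, traces and ranks of projections -/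

section HilbertSchmidt

variable {H : Type*} [NormedAddCommGroup H] [InnerProductSpace ℂ H] [CompleteSpace H]

/-- The square of the Hilbert–Schmidt norm of an operator, computed along a Hilbert basis. -/
def hsNormSq {ι : Type*} (e : HilbertBasis ι ℂ H) (S : H →L[ℂ] H) : ℝ≥0∞ :=
  ∑' i, ENNReal.ofReal (‖S (e i)‖ ^ 2)

theorem inner_star_left (S : H →L[ℂ] H) (x y : H) : ⟪(star S) x, y⟫_ℂ = ⟪x, S y⟫_ℂ :=
  ContinuousLinearMap.adjoint_inner_left S y x

theorem inner_star_right (S : H →L[ℂ] H) (x y : H) : ⟪x, (star S) y⟫_ℂ = ⟪S x, y⟫_ℂ :=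
  ContinuousLinearMap.adjoint_inner_right S x y

/-- Both sides are the double sum of |⟪f j, S (e i)⟫|², whose order may be exchanged in [0, ∞]. -/
theorem hsNormSq_star {ι κ : Type*} (e : HilbertBasis ι ℂ H) (f : HilbertBasis κ ℂ H)
    (S : H →L[ℂ] H) : hsNormSq e S = hsNormSq f (star S) := by
  unfold hsNormSq
  simp_rw [fun i => (tsum_sq_inner f (S (e i))).symm]
  rw [ENNReal.tsum_comm]
  refine tsum_congr fun j => ?_
  rw [← tsum_sq_inner e]
  refine tsum_congr fun i => ?_
  rw [inner_star_right, norm_inner_symm]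

theorem norm_sq_le_hsNormSq {ι : Type*} (e : HilbertBasis ι ℂ H) (S : H →L[ℂ] H) :
    ENNReal.ofReal (‖S‖ ^ 2) ≤ hsNormSq e S := by
  by_cases hfin : hsNormSq e S = ∞
  · simp [hfin]
  have key : ∀ y, ‖(star S) y‖ ≤ √(hsNormSq e S).toReal * ‖y‖ := fun y => by
    have h1 : ENNReal.ofReal (‖(star S) y‖ ^ 2) ≤ hsNormSq e S * ENNReal.ofReal (‖y‖ ^ 2) := by
      rw [← tsum_sq_inner e, hsNormSq, ← ENNReal.tsum_mul_right]
      refine ENNReal.tsum_le_tsum fun i => ?_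
      rw [inner_star_right, ← ENNReal.ofReal_mul (by positivity), ← mul_pow]
      exact ENNReal.ofReal_le_ofReal
        (pow_le_pow_left₀ (norm_nonneg _) (norm_inner_le_norm _ _) 2)
    have h2 := ENNReal.toReal_mono (ENNReal.mul_ne_top hfin ENNReal.ofReal_ne_top) h1
    rw [ENNReal.toReal_mul, ENNReal.toReal_ofReal (by positivity),
      ENNReal.toReal_ofReal (by positivity)] at h2
    refine (sq_le_sq₀ (norm_nonneg _) (by positivity)).1 ?_
    rwa [mul_pow, Real.sq_sqrt ENNReal.toReal_nonneg]
  have h3 : ‖S‖ ≤ √(hsNormSq e S).toReal := by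
    rw [← norm_star]
    exact ContinuousLinearMap.opNorm_le_bound _ (Real.sqrt_nonneg _) key
  rw [ENNReal.ofReal_le_iff_le_toReal hfin,
    ← Real.sq_sqrt (ENNReal.toReal_nonneg (a := hsNormSq e S))]
  exact pow_le_pow_left₀ (norm_nonneg _) h3 2

/-- Restricting S to the span of finitely many basis vectors gives finite-rank operators; the norm
of the error is bounded by the tail of a convergent series. -/
theorem isCompactOperator_of_hsNormSq_lt_top {ι : Type*} (e : HilbertBasis ι ℂ H)
    {S : H →L[ℂ] H} (hS : hsNormSq e S < ∞) : IsCompactOperator S := by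
  classical
  let V : Finset ι → Submodule ℂ H := fun s => Submodule.span ℂ (e '' s)
  have hV : ∀ s, FiniteDimensional ℂ (V s) := fun s =>
    FiniteDimensional.span_of_finite ℂ (s.finite_toSet.image e)
  have hmem : ∀ s, ∀ i ∈ s, (V s).starProjection (e i) = e i := fun s i hi =>
    Submodule.starProjection_eq_self_iff.2 (Submodule.subset_span ⟨i, hi, rfl⟩)
  have hnot : ∀ s, ∀ i ∉ s, (V s).starProjection (e i) = 0 := fun s i hi => by
    rw [Submodule.starProjection_apply_eq_zero_iff, Submodule.mem_orthogonal]
    intro u hu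
    induction hu using Submodule.span_induction with
    | mem x hx =>
      obtain ⟨j, hj, rfl⟩ := hx
      exact e.orthonormal.2 (fun h => hi (h ▸ hj))
    | zero => simp
    | add x y _ _ hx hy => rw [inner_add_left, hx, hy, add_zero]
    | smul c x _ hx => rw [inner_smul_left, hx, mul_zero]
  have hcomp : ∀ s, IsCompactOperator (S ∘L (V s).starProjection) := fun s => by
    have : LocallyCompactSpace (V s) := have := FiniteDimensional.proper ℂ (V s); inferInstance
    have h1 : IsCompactOperator (V s).orthogonalProjectionOnto :=
      (isCompactOperator_id (E := V s)).comp_clm (V s).orthogonalProjectionOnto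
    exact h1.clm_comp (S ∘L (V s).subtypeL)
  have hsum : ∀ s, hsNormSq e (S - S ∘L (V s).starProjection)
      = ∑' i : {i // i ∉ s}, ENNReal.ofReal (‖S (e i)‖ ^ 2) := fun s => by
    refine Eq.trans ?_ (tsum_subtype {i | i ∉ s} (fun i => ENNReal.ofReal (‖S (e i)‖ ^ 2))).symm
    refine tsum_congr fun i => ?_
    by_cases hi : i ∈ s
    · simp [hi, hmem s i hi]
    · simp [hi, hnot s i hi]
  have hlim : Tendsto (fun s => S ∘L (V s).starProjection) atTop (𝓝 S) := by
    rw [tendsto_iff_norm_sub_tendsto_zero]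
    have h0 := ENNReal.tendsto_tsum_compl_atTop_zero hS.ne
    have h1 : Tendsto (fun s => ENNReal.ofReal (‖S - S ∘L (V s).starProjection‖ ^ 2)) atTop
        (𝓝 0) :=
      tendsto_of_tendsto_of_tendsto_of_le_of_le tendsto_const_nhds h0 (fun _ => zero_le)
        (fun s => (norm_sq_le_hsNormSq e _).trans (hsum s).le)
    have h2 := (ENNReal.tendsto_toReal ENNReal.zero_ne_top).comp h1
    have h3 := (Real.continuous_sqrt.tendsto _).comp h2
    simp only [ENNReal.toReal_zero, Real.sqrt_zero] at h3
    refine h3.congr fun s => ?_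
    simp only [Function.comp]
    rw [ENNReal.toReal_ofReal (by positivity), Real.sqrt_sq (norm_nonneg _), norm_sub_rev]
  exact isCompactOperator_of_tendsto hlim (Eventually.of_forall hcomp)

theorem IsStarProjection.norm_sq_apply {p : H →L[ℂ] H} (hp : IsStarProjection p) (x : H) :
    ‖p x‖ ^ 2 = RCLike.re ⟪x, p x⟫_ℂ := by
  conv_rhs => rw [← hp.isIdempotentElem.eq]
  rw [mul_apply_eq_comp, ← inner_star_left, hp.isSelfAdjoint.star_eq,
    inner_self_eq_norm_sq]

theorem IsStarProjection.posTrace_eq {ι : Type*} (e : HilbertBasis ι ℂ H) {p : H →L[ℂ] H}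
    (hp : IsStarProjection p) : posTrace p = hsNormSq e p := by
  rw [posTrace_eq_tsum e ((ContinuousLinearMap.nonneg_iff_isPositive p).1 hp.nonneg)]
  exact tsum_congr fun i => by rw [hp.norm_sq_apply]

omit [CompleteSpace H] in
theorem hsNormSq_starProjection {ι κ : Type*} (e : HilbertBasis ι ℂ H) (K : Submodule ℂ H)
    [CompleteSpace K] (f : HilbertBasis κ ℂ K) :
    hsNormSq e K.starProjection = ENat.card κ := by
  have h : ∀ x : H, ENNReal.ofReal (‖K.starProjection x‖ ^ 2)
      = ∑' j, ENNReal.ofReal (‖⟪(f j : H), x⟫_ℂ‖ ^ 2) := fun x => by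
    rw [Submodule.starProjection_apply, ← Submodule.coe_norm, ← tsum_sq_inner f]
    refine tsum_congr fun j => ?_
    rw [Submodule.inner_orthogonalProjectionOnto_eq_of_mem_left]
  rw [hsNormSq]
  simp_rw [h]
  rw [ENNReal.tsum_comm, ← ENNReal.tsum_one]
  refine tsum_congr fun j => ?_
  simp_rw [norm_inner_symm (f j : H)]
  rw [tsum_sq_inner e]
  have := f.orthonormal.1 j
  rw [Submodule.coe_norm] at this
  simp [this]

omit [CompleteSpace H] in
theorem hsNormSq_starProjection_eq_finrank {ι : Type*} (e : HilbertBasis ι ℂ H)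
    (K : Submodule ℂ H) [CompleteSpace K] (h : hsNormSq e K.starProjection < ∞) :
    FiniteDimensional ℂ K ∧ hsNormSq e K.starProjection = Module.finrank ℂ K := by
  obtain ⟨κ, f, -⟩ := exists_hilbertBasis ℂ K
  rw [hsNormSq_starProjection e K f] at h ⊢
  have hfin : Finite κ := by
    by_contra hinf
    rw [not_finite_iff_infinite] at hinf
    simp [ENat.card_eq_top_of_infinite] at h
  have := Fintype.ofFinite κ
  refine ⟨f.toOrthonormalBasis.toBasis.finiteDimensional_of_finite, ?_⟩
  rw [Module.finrank_eq_card_basis f.toOrthonormalBasis.toBasis, ENat.card_eq_coe_fintype_card,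
    ENat.toENNReal_coe]

-- Each `e i` is orthogonal to all but countably many `f j`, and no unit vector `f j` is orthogonal
-- to every `e i`.
omit [CompleteSpace H] in
theorem HilbertBasis.countable_of_hilbertBasis {ι κ : Type*} [Countable ι]
    (e : HilbertBasis ι ℂ H) (K : Submodule ℂ H) [CompleteSpace K] (f : HilbertBasis κ ℂ K) :
    Countable κ := by
  rw [← Set.countable_univ_iff]
  have hcount : ∀ i, {j | ⟪(f j : H), e i⟫_ℂ ≠ 0}.Countable := fun i => by
    have h := tsum_sq_inner f (K.orthogonalProjectionOnto (e i))
    have h2 := Summable.countable_support_ennreal (h.trans_ne ENNReal.ofReal_ne_top)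
    refine h2.mono fun j hj => ?_
    simp only [Function.mem_support, ne_eq, ENNReal.ofReal_eq_zero, not_le]
    rw [Submodule.inner_orthogonalProjectionOnto_eq_of_mem_left]
    have : 0 < ‖⟪(f j : H), e i⟫_ℂ‖ := norm_pos_iff.2 hj
    positivity
  refine (Set.countable_iUnion hcount).mono fun j _ => ?_
  by_contra hne
  simp only [Set.mem_iUnion, Set.mem_ofPred_eq, not_exists, not_not] at hne
  have h := tsum_sq_inner e (f j : H)
  simp_rw [norm_inner_symm (e _), hne] at h
  have h1 := f.orthonormal.1 j
  rw [← Submodule.coe_norm] at h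
  simp [h1] at h

/-- The range is separable and infinite-dimensional, hence unitarily equivalent to H. This excludes
the default value 0 in `essCodim`. -/
theorem IsStarProjection.exists_isometry (e : HilbertBasis ℕ ℂ H) {p : H →L[ℂ] H}
    (hp : IsStarProjection p) (h : posTrace p = ∞) :
    ∃ w : H →L[ℂ] H, star w * w = 1 ∧ w * star w = p := by
  have hpt := hp.posTrace_eq e
  obtain ⟨K, hK, rfl⟩ := isStarProjection_iff_eq_starProjection.1 hp
  have hKc : CompleteSpace K := by
    have hcl : IsClosed (K : Set H) := by
      rw [← K.orthogonal_orthogonal]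
      exact Kᗮ.isClosed_orthogonal
    exact hcl.completeSpace_coe
  obtain ⟨κ, f, -⟩ := exists_hilbertBasis ℂ K
  have hcount := e.countable_of_hilbertBasis K f
  have hinf : Infinite κ := by
    by_contra hfin
    rw [not_infinite_iff_finite] at hfin
    have := Fintype.ofFinite κ
    rw [h, hsNormSq_starProjection e K f, ENat.card_eq_coe_fintype_card, ENat.toENNReal_coe] at hpt
    exact ENNReal.natCast_ne_top _ hpt.symm
  obtain ⟨σ⟩ := nonempty_equiv_of_countable (α := ℕ) (β := κ)
  let g : HilbertBasis ℕ ℂ K := HilbertBasis.mk (f.orthonormal.comp σ σ.injective) (by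
    rw [EquivLike.range_comp f σ]
    exact f.dense_span.ge)
  let U : H ≃ₗᵢ[ℂ] K := e.repr.trans g.repr.symm
  let w : H →L[ℂ] H := K.subtypeL ∘L (U : H →L[ℂ] K)
  have hw : ∀ x, w x = U x := fun _ => rfl
  have hww : star w * w = 1 := by
    refine ContinuousLinearMap.ext fun x => ext_inner_right ℂ fun y => ?_
    rw [mul_apply_eq_comp, inner_star_left, hw, hw, ← Submodule.coe_inner, U.inner_map_map]
    rfl
  refine ⟨w, hww, ?_⟩
  have hpw : K.starProjection * w = w := by
    ext x
    rw [mul_apply_eq_comp, Submodule.starProjection_eq_self_iff, hw]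
    exact (U x).2
  ext y
  have h1 : star w * K.starProjection = star w := by
    rw [← hp.isSelfAdjoint.star_eq, ← star_mul, hpw]
  have h2 : w (U.symm (K.orthogonalProjectionOnto y)) = K.starProjection y := by
    rw [hw, U.apply_symm_apply]; rfl
  rw [← h1, ← mul_assoc, mul_apply_eq_comp, ← h2, ← mul_apply_eq_comp, mul_assoc, hww, mul_one]

theorem norm_sq_apply_eq_inner (X : H →L[ℂ] H) (x : H) :
    ‖X x‖ ^ 2 = RCLike.re ⟪x, (star X * X) x⟫_ℂ := by
  rw [mul_apply_eq_comp, inner_star_right, inner_self_eq_norm_sq]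

theorem norm_sq_apply_congr {X Y : H →L[ℂ] H} (h : star X * X = star Y * Y) (x : H) :
    ‖X x‖ ^ 2 = ‖Y x‖ ^ 2 := by
  rw [norm_sq_apply_eq_inner, h, ← norm_sq_apply_eq_inner]

theorem hsNormSq_congr {ι : Type*} (e : HilbertBasis ι ℂ H) {X Y : H →L[ℂ] H}
    (h : star X * X = star Y * Y) : hsNormSq e X = hsNormSq e Y :=
  tsum_congr fun i => by rw [norm_sq_apply_congr h]

theorem posTrace_star_mul_self {ι : Type*} (e : HilbertBasis ι ℂ H) (X : H →L[ℂ] H) :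
    posTrace (star X * X) = hsNormSq e X := by
  rw [posTrace_eq_tsum e ((ContinuousLinearMap.nonneg_iff_isPositive _).1 (star_mul_self_nonneg X))]
  exact tsum_congr fun i => by rw [norm_sq_apply_eq_inner]

/-! ### Powers of the defect operators of a contraction -/

section Defect

variable {T R : H →L[ℂ] H}

theorem norm_sq_add_of_mul_self_eq (hR : IsSelfAdjoint R) (h : R * R = 1 - star T * T) (x : H) :
    ‖R x‖ ^ 2 + ‖T x‖ ^ 2 = ‖x‖ ^ 2 := by
  rw [norm_sq_apply_eq_inner, norm_sq_apply_eq_inner, hR.star_eq, h, ← map_add, ← inner_add_right,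
    ← add_apply, sub_add_cancel, one_apply_eq_self, inner_self_eq_norm_sq]

theorem hsNormSq_pow_succ_add {ι : Type*} (e : HilbertBasis ι ℂ H) (hR : IsSelfAdjoint R)
    (h : R * R = 1 - star T * T) (k : ℕ) :
    hsNormSq e (R ^ (k + 1)) + hsNormSq e (T * R ^ k) = hsNormSq e (R ^ k) := by
  unfold hsNormSq
  rw [← ENNReal.tsum_add]
  refine tsum_congr fun i => ?_
  rw [← ENNReal.ofReal_add (by positivity) (by positivity), pow_succ' R k, mul_apply_eq_comp,
    mul_apply_eq_comp, norm_sq_add_of_mul_self_eq hR h]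

/-- The intertwining T R² = S² T gives (T R^k)(T R^k)* = S^k T T* S^k. -/
theorem hsNormSq_mul_pow_swap {ι : Type*} (e : HilbertBasis ι ℂ H) {S : H →L[ℂ] H}
    (hR : IsSelfAdjoint R) (hS : IsSelfAdjoint S)
    (h : R * R = 1 - star T * T) (h' : S * S = 1 - T * star T) (k : ℕ) :
    hsNormSq e (T * R ^ k) = hsNormSq e (star T * S ^ k) := by
  rw [hsNormSq_star e e]
  apply hsNormSq_congr
  simp only [star_mul, star_star, star_pow, hR.star_eq, hS.star_eq]
  have h1 : SemiconjBy T (R * R) (S * S) := by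
    rw [SemiconjBy, h, h']; noncomm_ring
  have h2 : T * star T = 1 - S * S := by rw [h']; abel
  have h3 : Commute (S ^ k) (T * star T) := by
    rw [h2]
    exact ((Commute.one_right S).sub_right ((Commute.refl S).mul_right (Commute.refl S))).pow_left k
  calc T * R ^ k * (R ^ k * star T) = T * (R * R) ^ k * star T := by
        rw [(Commute.refl R).mul_pow]; noncomm_ring
    _ = (S * S) ^ k * T * star T := by rw [(h1.pow_right k).eq]
    _ = S ^ k * (S ^ k * (T * star T)) := by rw [(Commute.refl S).mul_pow]; noncomm_ring
    _ = S ^ k * T * (star T * S ^ k) := by rw [h3.eq]; noncomm_ring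

theorem antitone_norm_sq_pow_apply (hR : IsSelfAdjoint R) (h : R * R = 1 - star T * T) (x : H) :
    Antitone fun k => ‖(R ^ k) x‖ ^ 2 :=
  antitone_nat_of_succ_le fun k => by
    rw [pow_succ' R k, mul_apply_eq_comp, ← norm_sq_add_of_mul_self_eq hR h ((R ^ k) x)]
    exact le_add_of_nonneg_right (by positivity)

theorem apply_eq_zero_iff_mul_self_apply (h : R * R = 1 - star T * T) (x : H) :
    T x = 0 ↔ (R * R) x = x := by
  rw [h, sub_apply, one_apply_eq_self, sub_eq_self]
  refine ⟨fun hx => by rw [mul_apply_eq_comp, hx, map_zero], fun hx => ?_⟩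
  have := norm_sq_apply_eq_inner T x
  rw [hx, inner_zero_right, map_zero] at this
  simpa using this

theorem cauchySeq_pow_apply (hR : IsSelfAdjoint R) (h : R * R = 1 - star T * T) (x : H) :
    CauchySeq fun k => (R ^ (2 * k)) x := by
  obtain ⟨L, hL⟩ : ∃ L, Tendsto (fun k => ‖(R ^ k) x‖ ^ 2) atTop (𝓝 L) :=
    ⟨_, tendsto_atTop_ciInf (antitone_norm_sq_pow_apply hR h x)
      ⟨0, by rintro _ ⟨k, rfl⟩; positivity⟩⟩
  have hin : ∀ k l, RCLike.re ⟪(R ^ (2 * k)) x, (R ^ (2 * l)) x⟫_ℂ = ‖(R ^ (k + l)) x‖ ^ 2 :=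
    fun k l => by
      have h1 : R ^ (2 * k) = star (R ^ (2 * k)) := by rw [star_pow, hR.star_eq]
      rw [h1, inner_star_left, ← mul_apply_eq_comp, norm_sq_apply_eq_inner, star_pow, hR.star_eq,
        ← pow_add, ← pow_add, show 2 * k + 2 * l = k + l + (k + l) by ring]
  rw [Metric.cauchySeq_iff']
  intro ε hε
  -- The squared distance expands into limits of ‖R^j x‖² with coefficients 1, -2, 1, so four errors
  -- of ε²/4 suffice.
  have hlim := Metric.tendsto_atTop.1 hL (ε ^ 2 / 4) (by positivity)
  obtain ⟨N, hN⟩ := hlim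
  refine ⟨N, fun k hk => ?_⟩
  have hd : ‖(R ^ (2 * k)) x - (R ^ (2 * N)) x‖ ^ 2 < ε ^ 2 := by
    rw [@norm_sub_sq ℂ, hin]
    have h1 := abs_lt.1 (hN (2 * k) (by omega))
    have h2 := abs_lt.1 (hN (2 * N) (by omega))
    have h3 := abs_lt.1 (hN (k + N) (by omega))
    linarith [h1.1, h1.2, h2.1, h2.2, h3.1, h3.2]
  rw [dist_eq_norm]
  exact lt_of_pow_lt_pow_left₀ 2 hε.le hd

/-- Powers of a positive contraction converge strongly to the projection onto its fixed points. -/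
theorem tendsto_pow_apply (hR : IsSelfAdjoint R) (h : R * R = 1 - star T * T) (x : H) :
    Tendsto (fun k => (R ^ (2 * k)) x) atTop (𝓝 ((T.ker).starProjection x)) := by
  have hfix : ∀ v ∈ T.ker, ∀ k : ℕ, (R ^ (2 * k)) v = v := fun v hv k => by
    have hv' := (apply_eq_zero_iff_mul_self_apply h v).1 hv
    rw [pow_mul, pow_two]
    induction k with
    | zero => simp
    | succ k ih => rw [pow_succ, mul_apply_eq_comp, hv', ih]
  -- The limit is fixed by R², so it lies in ker T; it is also orthogonal to ker T, because R^(2k)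
  -- fixes that kernel. Hence it vanishes.
  have horth : ∀ v ∈ T.kerᗮ, Tendsto (fun k => (R ^ (2 * k)) v) atTop (𝓝 0) := fun v hv => by
    obtain ⟨y, hy⟩ := cauchySeq_tendsto_of_complete (cauchySeq_pow_apply hR h v)
    have h1 : (R * R) y = y := by
      refine tendsto_nhds_unique (((R * R).continuous.tendsto y).comp hy) ?_
      refine (hy.comp (tendsto_add_atTop_nat 1)).congr fun k => ?_
      simp only [Function.comp]
      rw [← mul_apply_eq_comp, ← pow_two, ← pow_add, mul_add, mul_one, add_comm]
    have hyk : y ∈ T.ker := (apply_eq_zero_iff_mul_self_apply h y).2 h1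
    have h2 : Tendsto (fun k => ⟪y, (R ^ (2 * k)) v⟫_ℂ) atTop (𝓝 ⟪y, y⟫_ℂ) :=
      tendsto_const_nhds.inner hy
    have h3 : ∀ k, ⟪y, (R ^ (2 * k)) v⟫_ℂ = 0 := fun k => by
      rw [← hR.star_eq, ← star_pow, inner_star_right, hfix y hyk]
      exact Submodule.inner_right_of_mem_orthogonal hyk hv
    simp only [h3] at h2
    have h4 : y = 0 := inner_self_eq_zero.1 (tendsto_nhds_unique h2 tendsto_const_nhds)
    rwa [h4] at hy
  have hsub : x - T.ker.starProjection x ∈ T.kerᗮ := T.ker.sub_starProjection_mem_orthogonal x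
  have := (horth _ hsub).const_add (T.ker.starProjection x)
  rw [add_zero] at this
  refine this.congr fun k => ?_
  rw [map_sub, hfix _ (Submodule.starProjection_apply_mem _ x), add_sub_cancel]

theorem hsNormSq_pow_le {ι : Type*} (e : HilbertBasis ι ℂ H) (hR : IsSelfAdjoint R)
    (h : R * R = 1 - star T * T) (k : ℕ) : hsNormSq e (R ^ (k + 1)) ≤ hsNormSq e R :=
  ENNReal.tsum_le_tsum fun i => ENNReal.ofReal_le_ofReal <| by
    simpa using antitone_norm_sq_pow_apply hR h (e i) (Nat.le_add_left 1 k)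

theorem hsNormSq_ker_le {ι : Type*} (e : HilbertBasis ι ℂ H) (hR : IsSelfAdjoint R)
    (h : R * R = 1 - star T * T) : hsNormSq e T.ker.starProjection ≤ hsNormSq e R :=
  ENNReal.tsum_le_tsum fun i => ENNReal.ofReal_le_ofReal <| by
    refine le_of_tendsto ((tendsto_pow_apply hR h (e i)).norm.pow 2) ?_
    filter_upwards [eventually_ge_atTop 1] with k hk
    simpa using antitone_norm_sq_pow_apply hR h (e i) (show 1 ≤ 2 * k by omega)

theorem tendsto_hsNormSq_pow {ι : Type*} (e : HilbertBasis ι ℂ H) (hR : IsSelfAdjoint R)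
    (h : R * R = 1 - star T * T) (hfin : hsNormSq e R < ∞) :
    Tendsto (fun k => (hsNormSq e (R ^ (2 * k))).toReal) atTop
      (𝓝 (hsNormSq e T.ker.starProjection).toReal) := by
  have hreal : ∀ X : H →L[ℂ] H, (hsNormSq e X).toReal = ∑' i, ‖X (e i)‖ ^ 2 := fun X => by
    rw [hsNormSq, ENNReal.tsum_toReal_eq (fun _ => ENNReal.ofReal_ne_top)]
    exact tsum_congr fun i => ENNReal.toReal_ofReal (by positivity)
  have hsum : Summable fun i => ‖R (e i)‖ ^ 2 := by
    refine (ENNReal.summable_toReal hfin.ne).congr fun i => ?_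
    exact ENNReal.toReal_ofReal (by positivity)
  simp_rw [hreal]
  refine tendsto_tsum_of_dominated_convergence hsum
    (fun i => (tendsto_pow_apply hR h (e i)).norm.pow 2) ?_
  filter_upwards [eventually_ge_atTop 1] with k hk i
  rw [Real.norm_of_nonneg (by positivity)]
  simpa using antitone_norm_sq_pow_apply hR h (e i) (show 1 ≤ 2 * k by omega)

end Defect

/-- The trace formula for the defects of a contraction with trace class defect operators. -/
theorem hsNormSq_sub_eq_finrank_ker_sub {ι : Type*} (e : HilbertBasis ι ℂ H) {T R S : H →L[ℂ] H}
    (hR : IsSelfAdjoint R) (hS : IsSelfAdjoint S)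
    (h : R * R = 1 - star T * T) (h' : S * S = 1 - T * star T)
    (hRfin : hsNormSq e R < ∞) (hSfin : hsNormSq e S < ∞) :
    (hsNormSq e R).toReal - (hsNormSq e S).toReal
      = (Module.finrank ℂ T.ker : ℝ) - Module.finrank ℂ (star T).ker := by
  have h'' : S * S = 1 - star (star T) * star T := by rwa [star_star]
  -- Raising the exponent removes the same finite quantity from both terms. Exponents start at 1
  -- since the identity need not have finite Hilbert–Schmidt norm.
  have hconst : ∀ k : ℕ, (hsNormSq e (R ^ (k + 1))).toReal - (hsNormSq e (S ^ (k + 1))).toReal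
      = (hsNormSq e R).toReal - (hsNormSq e S).toReal := fun k => by
    induction k with
    | zero => simp
    | succ k ih =>
      rw [← ih, ← hsNormSq_pow_succ_add e hR h (k + 1), ← hsNormSq_pow_succ_add e hS h'' (k + 1),
        hsNormSq_mul_pow_swap e hR hS h h' (k + 1)]
      have h1 := ((hsNormSq_pow_le e hR h (k + 1)).trans_lt hRfin).ne
      have h2 := ((hsNormSq_pow_le e hS h'' (k + 1)).trans_lt hSfin).ne
      have h3 : hsNormSq e (star T * S ^ (k + 1)) ≠ ∞ := by
        refine ((le_add_self.trans (hsNormSq_pow_succ_add e hS h'' (k + 1)).le).trans_lt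
          ((hsNormSq_pow_le e hS h'' k).trans_lt hSfin)).ne
      rw [ENNReal.toReal_add h1 h3, ENNReal.toReal_add h2 h3]
      ring
  have hlim := (tendsto_hsNormSq_pow e hR h hRfin).sub (tendsto_hsNormSq_pow e hS h'' hSfin)
  have hlim2 : Tendsto (fun k : ℕ => (hsNormSq e (R ^ (2 * k))).toReal
      - (hsNormSq e (S ^ (2 * k))).toReal) atTop
      (𝓝 ((hsNormSq e R).toReal - (hsNormSq e S).toReal)) := by
    refine tendsto_const_nhds.congr' ?_
    filter_upwards [eventually_ge_atTop 1] with k hk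
    obtain ⟨l, hl⟩ : ∃ l, 2 * k = l + 1 := ⟨2 * k - 1, by omega⟩
    rw [hl, hconst]
  rw [tendsto_nhds_unique hlim2 hlim,
    (hsNormSq_starProjection_eq_finrank e _ ((hsNormSq_ker_le e hR h).trans_lt hRfin)).2,
    (hsNormSq_starProjection_eq_finrank e _ ((hsNormSq_ker_le e hS h'').trans_lt hSfin)).2]
  simp

/-! ### Closed range and the index formula -/

/-- Fredholm alternative: TT* plus the projection onto ker T* is injective and differs from the
identity by a compact operator, so it is surjective. -/
theorem range_eq_orthogonal_ker_star {T S : H →L[ℂ] H}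
    (h' : S * S = 1 - T * star T) (hS : IsCompactOperator S)
    [FiniteDimensional ℂ (star T).ker] : T.range = (star T).kerᗮ := by
  have hT : ∀ x, T x ∈ (star T).kerᗮ := fun x => by
    rw [Submodule.mem_orthogonal]
    intro u hu
    rw [← inner_star_left, show (star T) u = 0 from hu, inner_zero_left]
  apply le_antisymm
  · rintro _ ⟨x, rfl⟩
    exact hT x
  intro y hy
  set L := (star T).ker
  let C : H →L[ℂ] H := S * S - L.starProjection
  have hC : IsCompactOperator C := by
    have : LocallyCompactSpace L := have := FiniteDimensional.proper ℂ L; inferInstance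
    have h1 : IsCompactOperator L.starProjection :=
      ((isCompactOperator_id (E := L)).comp_clm L.orthogonalProjectionOnto).clm_comp L.subtypeL
    exact (hS.clm_comp S).sub h1
  have hC1 : ∀ x, x - C x = T ((star T) x) + L.starProjection x := fun x => by
    simp only [C, h', sub_apply, one_apply_eq_self, mul_apply_eq_comp]
    abel
  have hev : ¬ Module.End.HasEigenvalue (C : Module.End ℂ H) 1 := by
    intro hE
    obtain ⟨x, hx⟩ := hE.exists_hasEigenvector
    have hx1 : C x = x := by simpa using hx.apply_eq_smul
    have h1 := hC1 x
    rw [hx1, sub_self] at h1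
    have h2 : RCLike.re ⟪x, T ((star T) x) + L.starProjection x⟫_ℂ = 0 := by
      rw [← h1, inner_zero_right, map_zero]
    rw [inner_add_right, map_add, ← inner_star_left, inner_self_eq_norm_sq,
      ← isStarProjection_starProjection.norm_sq_apply] at h2
    have h3 : (star T) x = 0 := by
      have : ‖(star T) x‖ ^ 2 = 0 := by
        nlinarith [sq_nonneg ‖(star T) x‖, sq_nonneg ‖L.starProjection x‖]
      simpa using this
    rw [h3, map_zero, zero_add, (Submodule.starProjection_eq_self_iff (K := L)).2 h3] at h1
    exact hx.2 h1.symm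
  have hres := (hC.hasEigenvalue_or_mem_resolventSet one_ne_zero).resolve_left hev
  obtain ⟨u, hu⟩ := spectrum.mem_resolventSet_iff.1 hres
  have hx : y = T ((star T) (u⁻¹.1 y)) + L.starProjection (u⁻¹.1 y) := by
    rw [← hC1]
    have : (u.1 * u⁻¹.1) y = y := by simp
    rw [mul_apply_eq_comp, hu] at this
    simpa using this.symm
  -- Both y and the range of T are orthogonal to L, so the L-component in `hx` vanishes.
  have hp := congrArg L.starProjection hx
  rw [map_add, (Submodule.starProjection_apply_eq_zero_iff L).2 hy,
    (Submodule.starProjection_apply_eq_zero_iff L).2 (hT _), zero_add,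
    ← mul_apply_eq_comp, L.isIdempotentElem_starProjection.eq] at hp
  rw [← hp, add_zero] at hx
  exact ⟨_, hx.symm⟩

/-- The index of a contraction whose defect operators are trace class. -/
theorem index_eq_posTrace_sub {ι : Type*} (e : HilbertBasis ι ℂ H) {T : H →L[ℂ] H}
    (hA : 0 ≤ 1 - star T * T) (hB : 0 ≤ 1 - T * star T)
    (hAfin : posTrace (1 - star T * T) < ∞) (hBfin : posTrace (1 - T * star T) < ∞) :
    (T.toLinearMap.index : ℝ)
      = (posTrace (1 - star T * T)).toReal - (posTrace (1 - T * star T)).toReal := by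
  obtain ⟨R, hR, h⟩ : ∃ R : H →L[ℂ] H, IsSelfAdjoint R ∧ R * R = 1 - star T * T :=
    ⟨CFC.sqrt _, (CFC.sqrt_nonneg _).isSelfAdjoint, CFC.sqrt_mul_sqrt_self _ hA⟩
  obtain ⟨S, hS, h'⟩ : ∃ S : H →L[ℂ] H, IsSelfAdjoint S ∧ S * S = 1 - T * star T :=
    ⟨CFC.sqrt _, (CFC.sqrt_nonneg _).isSelfAdjoint, CFC.sqrt_mul_sqrt_self _ hB⟩
  have hRt : posTrace (1 - star T * T) = hsNormSq e R := by
    rw [← h, ← posTrace_star_mul_self, hR.star_eq]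
  have hSt : posTrace (1 - T * star T) = hsNormSq e S := by
    rw [← h', ← posTrace_star_mul_self, hS.star_eq]
  rw [hRt] at hAfin ⊢
  rw [hSt] at hBfin ⊢
  rw [hsNormSq_sub_eq_finrank_ker_sub e hR hS h h' hAfin hBfin, LinearMap.index]
  have h'' : S * S = 1 - star (star T) * star T := by rwa [star_star]
  have hfd := (hsNormSq_starProjection_eq_finrank e _
    ((hsNormSq_ker_le e hS h'').trans_lt hBfin)).1
  have hrange := range_eq_orthogonal_ker_star h' (isCompactOperator_of_hsNormSq_lt_top e hBfin)
  have hq : Module.finrank ℂ (H ⧸ T.range) = Module.finrank ℂ (star T).ker := by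
    rw [hrange]
    exact (Submodule.quotientEquivOfIsCompl _ _
      (star T).ker.isCompl_orthogonal.symm).finrank_eq
  have hq' : Module.finrank ℂ (H ⧸ T.toLinearMap.range) = Module.finrank ℂ (star T).ker := hq
  rw [hq']
  push_cast
  rfl

end HilbertSchmidt

/-! ### Essential codimension of a pair of projections -/

section EssentialCodimension

variable {H : Type*} [NormedAddCommGroup H] [InnerProductSpace ℂ H] [CompleteSpace H]

theorem one_sub_star_mul_self_of_isometriesOnto {p q w v : H →L[ℂ] H} (hq : IsStarProjection q)
    (h : IsometriesOnto p q w v) :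
    1 - star (star v * w) * (star v * w) = star ((1 - q) * w) * ((1 - q) * w) := by
  obtain ⟨hw, -, -, hvq⟩ := h
  have h1 : star (1 - q) * (1 - q) = 1 - q := by
    rw [hq.one_sub.isSelfAdjoint.star_eq, hq.one_sub.isIdempotentElem.eq]
  calc 1 - star (star v * w) * (star v * w) = star w * w - star w * (v * star v) * w := by
        rw [hw, star_mul, star_star]; noncomm_ring
    _ = star w * (1 - q) * w := by rw [hvq]; noncomm_ring
    _ = star w * (star (1 - q) * (1 - q)) * w := by rw [h1]
    _ = _ := by rw [star_mul]; simp only [mul_assoc]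

/-- The defect is X*X with X = (1-q)w, and XX* = (1-q)p(1-q) because ww* = p. -/
theorem posTrace_one_sub_star_mul_self {ι : Type*} (e : HilbertBasis ι ℂ H)
    {p q w v : H →L[ℂ] H} (hp : IsStarProjection p) (hq : IsStarProjection q)
    (h : IsometriesOnto p q w v) :
    posTrace (1 - star (star v * w) * (star v * w)) = hsNormSq e (p * (1 - q)) := by
  rw [one_sub_star_mul_self_of_isometriesOnto hq h, posTrace_star_mul_self e, hsNormSq_star e e]
  apply hsNormSq_congr
  obtain ⟨-, hwp, -, -⟩ := h
  rw [star_star, star_mul, star_mul, hp.isSelfAdjoint.star_eq]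
  calc (1 - q) * w * (star w * star (1 - q)) = (1 - q) * (w * star w) * star (1 - q) := by
        noncomm_ring
    _ = (1 - q) * (p * p) * star (1 - q) := by rw [hwp, hp.isIdempotentElem.eq]
    _ = _ := by rw [hq.one_sub.isSelfAdjoint.star_eq]; noncomm_ring

theorem index_eq_of_isometriesOnto {ι : Type*} (e : HilbertBasis ι ℂ H)
    {p q w v : H →L[ℂ] H} (hp : IsStarProjection p) (hq : IsStarProjection q)
    (h : IsometriesOnto p q w v) (h1 : hsNormSq e (p * (1 - q)) < ∞)
    (h2 : hsNormSq e ((1 - p) * q) < ∞) :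
    ((star v * w : H →L[ℂ] H).toLinearMap.index : ℝ)
      = (hsNormSq e (p * (1 - q))).toReal - (hsNormSq e ((1 - p) * q)).toReal := by
  have hswap : IsometriesOnto q p v w := ⟨h.2.2.1, h.2.2.2, h.1, h.2.1⟩
  have hT : star w * v = star (star v * w) := by rw [star_mul, star_star]
  have e1 := posTrace_one_sub_star_mul_self e hp hq h
  have e2 := posTrace_one_sub_star_mul_self e hq hp hswap
  have pos2 := one_sub_star_mul_self_of_isometriesOnto hp hswap
  rw [hT, star_star] at e2 pos2
  rw [hsNormSq_star e e (q * (1 - p)), star_mul q (1 - p), hp.one_sub.isSelfAdjoint.star_eq,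
    hq.isSelfAdjoint.star_eq] at e2
  rw [← e1] at h1 ⊢
  rw [← e2] at h2 ⊢
  refine index_eq_posTrace_sub e ?_ ?_ h1 h2
  · rw [one_sub_star_mul_self_of_isometriesOnto hq h]
    exact star_mul_self_nonneg _
  · rw [pos2]
    exact star_mul_self_nonneg _

omit [CompleteSpace H] in
theorem hsNormSq_lt_top_iff {ι : Type*} (e : HilbertBasis ι ℂ H) (X : H →L[ℂ] H) :
    hsNormSq e X < ∞ ↔ Summable fun i => ‖X (e i)‖ ^ 2 := by
  refine ⟨fun h => (ENNReal.summable_toReal h.ne).congr fun i =>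
    ENNReal.toReal_ofReal (by positivity), fun h => ?_⟩
  rw [hsNormSq, ← ENNReal.ofReal_tsum_of_nonneg (fun _ => by positivity) h]
  exact ENNReal.ofReal_lt_top

omit [CompleteSpace H] in
theorem hasSum_hsNormSq {ι : Type*} (e : HilbertBasis ι ℂ H) {X : H →L[ℂ] H}
    (h : hsNormSq e X < ∞) : HasSum (fun i => ‖X (e i)‖ ^ 2) (hsNormSq e X).toReal := by
  have h1 := (hsNormSq_lt_top_iff e X).1 h
  rw [hsNormSq, ← ENNReal.ofReal_tsum_of_nonneg (fun _ => by positivity) h1,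
    ENNReal.toReal_ofReal (tsum_nonneg fun _ => by positivity)]
  exact h1.hasSum

theorem IsStarProjection.norm_sq_one_sub_apply {p : H →L[ℂ] H} (hp : IsStarProjection p) (x : H) :
    ‖(1 - p) x‖ ^ 2 = ‖x‖ ^ 2 - ‖p x‖ ^ 2 := by
  rw [hp.one_sub.norm_sq_apply, sub_apply, one_apply_eq_self, inner_sub_right, map_sub,
    inner_self_eq_norm_sq, ← hp.norm_sq_apply]

theorem IsStarProjection.exists_nat_posTrace_eq {ι : Type*} (e : HilbertBasis ι ℂ H)
    {p : H →L[ℂ] H} (hp : IsStarProjection p) (h : posTrace p < ∞) :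
    ∃ N : ℕ, posTrace p = N := by
  rw [hp.posTrace_eq e] at h ⊢
  obtain ⟨K, hK, rfl⟩ := isStarProjection_iff_eq_starProjection.1 hp
  have hKc : CompleteSpace K := by
    have hcl : IsClosed (K : Set H) := by
      rw [← K.orthogonal_orthogonal]
      exact Kᗮ.isClosed_orthogonal
    exact hcl.completeSpace_coe
  exact ⟨_, (hsNormSq_starProjection_eq_finrank e K h).2⟩

/-! ### The case of a diagonal projection q -/

section Diagonal

variable {p q : H →L[ℂ] H} {e : HilbertBasis ℕ ℂ H}

theorem norm_sq_sub_apply_of_diagonal (hp : IsStarProjection p)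
    (hqe : ∀ k, q (e k) = e k ∨ q (e k) = 0) (k : ℕ) :
    ‖(p - q) (e k)‖ ^ 2 = |‖p (e k)‖ ^ 2 - ‖q (e k)‖ ^ 2| := by
  rw [sub_apply]
  rcases hqe k with h | h
  · have h1 := hp.norm_sq_one_sub_apply (e k)
    rw [sub_apply, one_apply_eq_self] at h1
    rw [h, norm_sub_rev, h1, abs_sub_comm, abs_of_nonneg]
    rw [← h1]
    positivity
  · simp [h]

theorem isCompactOperator_sub_of_summable (hp : IsStarProjection p)
    (hqe : ∀ k, q (e k) = e k ∨ q (e k) = 0)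
    (hD : Summable fun k => ‖p (e k)‖ ^ 2 - ‖q (e k)‖ ^ 2) : IsCompactOperator (p - q) := by
  refine isCompactOperator_of_hsNormSq_lt_top e ((hsNormSq_lt_top_iff e _).2 ?_)
  simp_rw [norm_sq_sub_apply_of_diagonal hp hqe]
  exact hD.abs

/-- On each basis vector one of the two products vanishes: the first if q fixes the vector, the
second if q kills it. -/
theorem hasSum_of_diagonal (hp : IsStarProjection p) (hqe : ∀ k, q (e k) = e k ∨ q (e k) = 0)
    (hD : Summable fun k => ‖p (e k)‖ ^ 2 - ‖q (e k)‖ ^ 2) :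
    hsNormSq e (p * (1 - q)) < ∞ ∧ hsNormSq e ((1 - p) * q) < ∞ ∧
    HasSum (fun k => ‖p (e k)‖ ^ 2 - ‖q (e k)‖ ^ 2)
      ((hsNormSq e (p * (1 - q))).toReal - (hsNormSq e ((1 - p) * q)).toReal) := by
  have hpt : ∀ k, (‖(p * (1 - q)) (e k)‖ ^ 2 ≤ |‖p (e k)‖ ^ 2 - ‖q (e k)‖ ^ 2|) ∧
      (‖((1 - p) * q) (e k)‖ ^ 2 ≤ |‖p (e k)‖ ^ 2 - ‖q (e k)‖ ^ 2|) ∧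
      ‖(p * (1 - q)) (e k)‖ ^ 2 - ‖((1 - p) * q) (e k)‖ ^ 2
        = ‖p (e k)‖ ^ 2 - ‖q (e k)‖ ^ 2 := fun k => by
    have h1 := hp.norm_sq_one_sub_apply (e k)
    have h2 : (1 - q) (e k) = e k - q (e k) := by rw [sub_apply, one_apply_eq_self]
    rw [mul_apply_eq_comp, mul_apply_eq_comp, h2]
    rcases hqe k with h | h
    · rw [h, sub_self, map_zero, h1, abs_sub_comm]
      refine ⟨by simp, le_abs_self _, by simp⟩
    · rw [h, sub_zero, map_zero]
      simp
  have s1 := (hsNormSq_lt_top_iff e (p * (1 - q))).2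
    (Summable.of_nonneg_of_le (fun _ => by positivity) (fun k => (hpt k).1) hD.abs)
  have s2 := (hsNormSq_lt_top_iff e ((1 - p) * q)).2
    (Summable.of_nonneg_of_le (fun _ => by positivity) (fun k => (hpt k).2.1) hD.abs)
  refine ⟨s1, s2, ?_⟩
  simpa only [(hpt _).2.2] using (hasSum_hsNormSq e s1).sub (hasSum_hsNormSq e s2)

/-- Essential codimension as a sum of diagonal entries, when `q` is diagonal. -/
theorem essCodim_eq_of_hasSum (hp : IsStarProjection p) (hq : IsStarProjection q)
    (hqe : ∀ k, q (e k) = e k ∨ q (e k) = 0) {D : ℝ}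
    (hD : HasSum (fun k => ‖p (e k)‖ ^ 2 - ‖q (e k)‖ ^ 2) D) :
    D = essCodim p q ∧ ∃ N : ℤ, D = N := by
  have hpT := hp.posTrace_eq e
  have hqT := hq.posTrace_eq e
  -- The diagonals of p and q differ by a summable sequence.
  have hiff : posTrace p < ∞ ↔ posTrace q < ∞ := by
    rw [hpT, hqT, hsNormSq_lt_top_iff, hsNormSq_lt_top_iff]
    refine ⟨fun h => ?_, fun h => ?_⟩
    · simpa using h.sub hD.summable
    · simpa using h.add hD.summable
  rw [essCodim]
  split_ifs with hfin hex
  · obtain ⟨hpf, hqf⟩ := hfin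
    have hDeq : D = (posTrace p).toReal - (posTrace q).toReal := by
      obtain ⟨hpf', hqf'⟩ := And.intro hpf hqf
      rw [hpT] at hpf' ⊢
      rw [hqT] at hqf' ⊢
      exact hD.unique ((hasSum_hsNormSq e hpf').sub (hasSum_hsNormSq e hqf'))
    obtain ⟨N, hN⟩ := hp.exists_nat_posTrace_eq e hpf
    obtain ⟨M, hM⟩ := hq.exists_nat_posTrace_eq e hqf
    refine ⟨hDeq, (N : ℤ) - M, ?_⟩
    rw [hDeq, hN, hM]
    simp
  · obtain ⟨h1, h2, h3⟩ := hasSum_of_diagonal hp hqe hD.summable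
    have h4 := index_eq_of_isometriesOnto e hp hq hex.choose_spec h1 h2
    have h5 := (hD.unique h3).trans h4.symm
    exact ⟨h5, _, h5⟩
  · exfalso
    have hp' : posTrace p = ∞ := by
      by_contra h
      exact hfin ⟨lt_top_iff_ne_top.2 h, hiff.1 (lt_top_iff_ne_top.2 h)⟩
    have hq' : posTrace q = ∞ := by
      by_contra h
      exact hfin ⟨hiff.2 (lt_top_iff_ne_top.2 h), lt_top_iff_ne_top.2 h⟩
    obtain ⟨w, hw1, hw2⟩ := hp.exists_isometry e hp'
    obtain ⟨v, hv1, hv2⟩ := hq.exists_isometry e hq'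
    exact hex ⟨(w, v), hw1, hw2, hv1, hv2⟩

end Diagonal

end EssentialCodimension

/-! ### Spectral projections and the diagonal of z -/

section SpectralProjections

variable {H : Type*} [NormedAddCommGroup H] [InnerProductSpace ℂ H] [CompleteSpace H]
  {z : H →L[ℂ] H}

theorem isStarProjection_spectralProj (hfin : (spectrum ℝ z).Finite) (c : ℝ) :
    IsStarProjection (spectralProj z c) := by
  refine ⟨?_, cfc_predicate _ _⟩
  rw [IsIdempotentElem, spectralProj, ← cfc_mul _ _ z (hfin.continuousOn _) (hfin.continuousOn _)]
  refine cfc_congr fun x _ => ?_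
  by_cases hx : x = c <;> simp [hx]

theorem sum_indicator_of_injOn {κ : Type*} {I : Finset κ} {A g : κ → ℝ}
    (hinj : Set.InjOn A I) {i : κ} (hi : i ∈ I) :
    ∑ j ∈ I, g j * Set.indicator {A j} (fun _ : ℝ => (1 : ℝ)) (A i) = g i := by
  rw [Finset.sum_eq_single_of_mem i hi]
  · simp
  · intro j hj hji
    rw [Set.indicator_of_notMem, mul_zero]
    intro h
    exact hji (hinj hj hi (Set.mem_singleton_iff.1 h).symm)

theorem sum_smul_spectralProj {κ : Type*} {I : Finset κ} {A g : κ → ℝ}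
    {f : ℝ → ℝ} (hspec : spectrum ℝ z = A '' I) (hinj : Set.InjOn A I)
    (hf : ∀ j ∈ I, f (A j) = g j) :
    ∑ j ∈ I, g j • spectralProj z (A j) = cfc f z := by
  have hfin : (spectrum ℝ z).Finite := hspec ▸ I.finite_toSet.image A
  have h1 : ∀ j ∈ I, g j • spectralProj z (A j)
      = cfc (fun x => g j * Set.indicator {A j} (fun _ : ℝ => (1 : ℝ)) x) z := fun j _ => by
    rw [cfc_const_mul _ _ z (hfin.continuousOn _), spectralProj]
  rw [Finset.sum_congr rfl h1, ← cfc_sum _ _ _ (fun j _ => hfin.continuousOn _)]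
  refine cfc_congr fun x hx => ?_
  rw [hspec] at hx
  obtain ⟨i, hi, rfl⟩ := hx
  simp only [Finset.sum_apply]
  rw [sum_indicator_of_injOn hinj hi, hf i hi]

theorem re_inner_sum_smul {κ : Type*} (I : Finset κ) (g : κ → ℝ) (P : κ → H →L[ℂ] H)
    (hP : ∀ j, IsStarProjection (P j)) (x : H) :
    RCLike.re ⟪x, (∑ j ∈ I, g j • P j) x⟫_ℂ = ∑ j ∈ I, g j * ‖P j x‖ ^ 2 := by
  rw [sum_apply, inner_sum, map_sum]
  refine Finset.sum_congr rfl fun j _ => ?_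
  rw [(hP j).norm_sq_apply, smul_apply, ← Complex.coe_smul, inner_smul_right]
  exact Complex.re_ofReal_mul _ _

theorem upperProj_apply_basis (e : HilbertBasis ℕ ℂ H) (k : ℕ) :
    upperProj e z (e k) = if 1 / 2 < diagEntry e z k then e k else 0 := by
  rw [upperProj]
  split_ifs with hk
  · exact Submodule.starProjection_eq_self_iff.2
      (Submodule.le_topologicalClosure _ (Submodule.subset_span ⟨k, hk, rfl⟩))
  · rw [Submodule.starProjection_apply_eq_zero_iff, Submodule.orthogonal_closure,
      Submodule.mem_orthogonal]
    intro u hu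
    induction hu using Submodule.span_induction with
    | mem x hx =>
      obtain ⟨j, hj, rfl⟩ := hx
      exact e.orthonormal.2 (fun h => hk (h ▸ hj))
    | zero => simp
    | add x y _ _ hx hy => rw [inner_add_left, hx, hy, add_zero]
    | smul c x _ hx => rw [inner_smul_left, hx, mul_zero]

end SpectralProjections

/-- Once the summable negative part is subtracted, the remaining terms are nonnegative, so their sum
dominates each of them. -/
theorem summable_of_summable_sum {κ : Type*} {I : Finset κ} {c : κ → ℝ} {y : κ → ℕ → ℝ}
    (hy : ∀ j ∈ I, ∀ k, 0 ≤ y j k) (hsum : Summable fun k => ∑ j ∈ I, c j * y j k)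
    (hneg : ∀ j ∈ I, c j < 0 → Summable (y j)) {i : κ} (hi : i ∈ I) (hci : 0 < c i) :
    Summable (y i) := by
  classical
  have h1 : Summable fun k => ∑ j ∈ I.filter (fun j => c j < 0), c j * y j k :=
    summable_sum fun j hj => (hneg j (Finset.mem_filter.1 hj).1 (Finset.mem_filter.1 hj).2).mul_left _
  have h2 : Summable fun k => c i * y i k := by
    refine Summable.of_nonneg_of_le (fun k => mul_nonneg hci.le (hy i hi k)) (fun k => ?_)
      (hsum.sub h1)
    rw [← Finset.sum_filter_add_sum_filter_not I (fun j => c j < 0) (fun j => c j * y j k),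
      add_sub_cancel_left]
    refine Finset.single_le_sum (f := fun j => c j * y j k) (fun j hj => ?_)
      (Finset.mem_filter.2 ⟨hi, hci.not_gt⟩)
    exact mul_nonneg (not_lt.1 (Finset.mem_filter.1 hj).2) (hy j (Finset.mem_filter.1 hj).1 k)
  exact (summable_mul_left_iff hci.ne').1 h2

/-! ### The main theorem -/

theorem theorem4p1 {H : Type*} [NormedAddCommGroup H] [InnerProductSpace ℂ H] [CompleteSpace H]
    (e : HilbertBasis ℕ ℂ H)
    (z : H →L[ℂ] H) (hz : IsSelfAdjoint z)
    (m n r : ℕ) (hr : 1 ≤ r) (A : ℤ → ℝ)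
    (hmono : StrictMonoOn A (Set.Icc (-m : ℤ) (n + r)))
    (hspec : spectrum ℝ z = A '' Set.Icc (-m : ℤ) (n + r))
    (hA0 : A 0 = 0) (hA1 : A (n + 1) = 1)
    (hfin : ∀ j ∈ Set.Icc (-m : ℤ) (n + r), j < 0 ∨ (n + 1 : ℤ) < j →
      posTrace (spectralProj z (A j)) < ∞)
    (a b : ℝ)
    (ha : HasSum (fun k : {k : ℕ // diagEntry e z k ≤ 1 / 2} => diagEntry e z k) a)
    (hb : HasSum (fun k : {k : ℕ // 1 / 2 < diagEntry e z k} => 1 - diagEntry e z k) b) :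
    (∀ j : ℤ, 0 < j → j < n + 1 → posTrace (spectralProj z (A j)) < ∞) ∧
    IsCompactOperator (spectralProj z 1 - upperProj e z) ∧
    a - b - ∑ j ∈ (Finset.Icc (-m : ℤ) (n + r)).erase (n + 1),
        A j * (posTrace (spectralProj z (A j))).toReal
      = essCodim (spectralProj z 1) (upperProj e z) ∧
    ∃ N : ℤ, a - b - ∑ j ∈ (Finset.Icc (-m : ℤ) (n + r)).erase (n + 1),
        A j * (posTrace (spectralProj z (A j))).toReal = N := by
  set I := Finset.Icc (-m : ℤ) (n + r) with hI
  have hIc : (I : Set ℤ) = Set.Icc (-m : ℤ) (n + r) := Finset.coe_Icc _ _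
  rw [← hIc] at hmono hspec hfin
  have h0I : (0 : ℤ) ∈ I := by rw [hI, Finset.mem_Icc]; omega
  have h1I : (n + 1 : ℤ) ∈ I := by rw [hI, Finset.mem_Icc]; omega
  have hsfin : (spectrum ℝ z).Finite := hspec ▸ I.finite_toSet.image A
  have hP : ∀ j, IsStarProjection (spectralProj z (A j)) := fun j =>
    isStarProjection_spectralProj hsfin _
  set d := diagEntry e z
  let x : ℤ → ℕ → ℝ := fun j k => ‖spectralProj z (A j) (e k)‖ ^ 2
  have hx0 : ∀ j k, 0 ≤ x j k := fun j k => by positivity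
  have hx1 : ∀ k, ∑ j ∈ I, x j k = 1 := fun k => by
    have h := re_inner_sum_smul I (fun _ => 1) (fun j => spectralProj z (A j)) hP (e k)
    rw [sum_smul_spectralProj (f := fun _ => 1) hspec hmono.injOn (fun _ _ => rfl),
      cfc_const_one ℝ z, one_apply_eq_self, inner_self_eq_norm_sq, e.orthonormal.1] at h
    simpa [x] using h.symm
  have hxd : ∀ k, ∑ j ∈ I, A j * x j k = d k := fun k => by
    have h := re_inner_sum_smul I A (fun j => spectralProj z (A j)) hP (e k)
    rw [sum_smul_spectralProj (g := A) (f := id) hspec hmono.injOn (fun _ _ => rfl), cfc_id ℝ z] at h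
    exact h.symm
  have htr : ∀ j, posTrace (spectralProj z (A j)) < ∞ ↔ Summable (x j) := fun j => by
    rw [(hP j).posTrace_eq e, hsNormSq_lt_top_iff]
  let Q : Set ℕ := {k | 1 / 2 < d k}
  have ha' : HasSum (Qᶜ.indicator d) a := by
    have hQ : Qᶜ = {k | d k ≤ 1 / 2} := by ext k; simp [Q]
    rw [hQ]
    exact hasSum_subtype_iff_indicator.1 ha
  have hb' : HasSum (Q.indicator fun k => 1 - d k) b := hasSum_subtype_iff_indicator.1 hb
  have hoff : ∀ j ∈ I, 0 < j → Summable (Qᶜ.indicator (x j)) := fun j hj hj0 => by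
    refine summable_of_summable_sum (c := A) (y := fun j => Qᶜ.indicator (x j))
      (fun j _ k => Set.indicator_nonneg (fun k _ => hx0 j k) k) ?_ (fun i hi hi0 => ?_) hj
      (hA0 ▸ hmono h0I hj hj0)
    · refine ha'.summable.congr fun k => ?_
      by_cases hk : k ∈ Qᶜ <;> simp [hk, hxd]
    · exact ((htr i).1 (hfin i hi (Or.inl ((hmono.lt_iff_lt hi h0I).1 (hA0.symm ▸ hi0))))).indicator _
  have hon : ∀ j ∈ I, j < n + 1 → Summable (Q.indicator (x j)) := fun j hj hj0 => by
    refine summable_of_summable_sum (c := fun j => 1 - A j) (y := fun j => Q.indicator (x j))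
      (fun j _ k => Set.indicator_nonneg (fun k _ => hx0 j k) k) ?_ (fun i hi hi0 => ?_) hj
      (sub_pos.2 (hA1 ▸ hmono hj h1I hj0))
    · refine hb'.summable.congr fun k => ?_
      by_cases hk : k ∈ Q
      · simp [hk, sub_mul, hxd, hx1]
      · simp [hk]
    · exact ((htr i).1 (hfin i hi (Or.inr
        ((hmono.lt_iff_lt h1I hi).1 (hA1.symm ▸ sub_neg.1 hi0))))).indicator _
  have hall : ∀ j ∈ I, j ≠ 0 → j ≠ n + 1 → Summable (x j) := fun j hj hj0 hj1 => by
    by_cases hout : j < 0 ∨ (n + 1 : ℤ) < j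
    · exact (htr j).1 (hfin j hj hout)
    · have := (hon j hj (by omega)).add (hoff j hj (by omega))
      refine this.congr fun k => ?_
      exact congrFun (Set.indicator_self_add_compl Q (x j)) k
  have hq : IsStarProjection (upperProj e z) := isStarProjection_starProjection
  have hqe : ∀ k, upperProj e z (e k) = e k ∨ upperProj e z (e k) = 0 := fun k => by
    rw [upperProj_apply_basis]
    split_ifs <;> simp
  have hp : IsStarProjection (spectralProj z 1) := isStarProjection_spectralProj hsfin _
  have hD : HasSum (fun k => ‖spectralProj z 1 (e k)‖ ^ 2 - ‖upperProj e z (e k)‖ ^ 2)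
      (a - b - ∑ j ∈ I.erase (n + 1), A j * (posTrace (spectralProj z (A j))).toReal) := by
    have hs : HasSum (fun k => ∑ j ∈ I.erase (n + 1), A j * x j k)
        (∑ j ∈ I.erase (n + 1), A j * (posTrace (spectralProj z (A j))).toReal) := by
      refine hasSum_sum fun j hj => ?_
      obtain ⟨hj1, hjI⟩ := Finset.mem_erase.1 hj
      -- The convention 0·∞ = 0: p_0 may have infinite trace, but its coefficient makes every term
      -- zero.
      by_cases hj0 : j = 0
      · simp [hj0, hA0, hasSum_zero]
      · refine HasSum.mul_left _ ?_
        have h := (htr j).2 (hall j hjI hj0 hj1)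
        rw [(hP j).posTrace_eq e] at h ⊢
        exact hasSum_hsNormSq e h
    -- Off Q the combination of `ha'` and `hb'` contributes d_k, and on Q it contributes d_k - 1;
    -- thus it is d_k - ‖q e_k‖² throughout.
    refine (congrArg (HasSum · _) (funext fun k => ?_)).mpr ((ha'.sub hb').sub hs)
    have hsplit : d k = x (n + 1) k + ∑ j ∈ I.erase (n + 1), A j * x j k := by
      rw [← hxd k, ← Finset.add_sum_erase I _ h1I, hA1, one_mul]
    have hxp : ‖spectralProj z 1 (e k)‖ ^ 2 = x (n + 1) k := by rw [← hA1]
    rw [hxp, upperProj_apply_basis]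
    by_cases hk : k ∈ Q
    · rw [if_pos (show 1 / 2 < diagEntry e z k from hk), e.orthonormal.1,
        Set.indicator_of_notMem (show k ∉ Qᶜ from fun h => h hk),
        Set.indicator_of_mem hk, hsplit]
      ring
    · rw [if_neg (show ¬ 1 / 2 < diagEntry e z k from hk),
        Set.indicator_of_mem (show k ∈ Qᶜ from hk), Set.indicator_of_notMem hk, hsplit, norm_zero]
      ring
  exact ⟨fun j hj0 hj1 => (htr j).2 (hall j (by rw [hI, Finset.mem_Icc]; omega) (by omega)
      (by omega)), isCompactOperator_sub_of_summable hp hqe hD.summable,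
    essCodim_eq_of_hasSum hp hq hqe hD⟩
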